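/- Let $m\ge 1$, let $\mathbb B^m=\{z\in\mathbb C^m:\sum_i|z_i|^2<1\}$, and for a complex Hilbert space $\mathcal E$ let $H^2_m\otimes\mathcal E=H^2_m(\mathcal E)$ be the $\mathcal E$-valued Drury–Arveson space, that is, the Hilbert space of ($\mathcal E$-valued, holomorphic) functions on $\mathbb B^m$ with reproducing kernel $(z,w)\mapsto\bigl(1-\sum_{i=1}^m z_i\bar w_i\bigr)^{-1}I_{\mathcal E}$. For complex Hilbert spaces $\mathcal E,\mathcal E_*$, let $\mathcal M(\mathcal E,\mathcal E_*)$ be the set of multipliers, i.e. of holomorphic functions $\varphi:\mathbb B^m\to\mathcal L(\mathcal E,\mathcal E_*)$ such that the pointwise product $\varphi f$ lies in $H^2_m\otimes\mathcal E_*$ for every $f\in H^2_m\otimes\mathcal E$; for such $\varphi$ let $M_\varphi:H^2_m\otimes\mathcal E\to H^2_m\otimes\mathcal E_*$, $M_\varphi f=\varphi f$, be the (automatically bounded) multiplication operator. A multiplier $\varphi$ is called inner if $M_\varphi$ is a partial isometry. Theorem. Let $\mathcal E,\mathcal E_*,\mathcal F$ be complex Hilbert spaces, let $\theta\in\mathcal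 M(\mathcal E,\mathcal E_*)$ be inner or, more generally, such that $\operatorname{ran}M_\theta$ is closed, and let $\varphi\in\mathcal M(\mathcal F,\mathcal E_*)$. Then there exists a multiplier $\psi\in\mathcal M(\mathcal F,\mathcal E)$ such that $\varphi(z)=\theta(z)\psi(z)$ for all $z\in\mathbb B^m$ if and only if $\operatorname{ran}M_\varphi\subseteq\operatorname{ran}M_\theta$. -/

import Mathlib

noncomputable section

namespace DruryArveson

/-- The open unit ball `𝔹^m` of `ℂ^m` (Euclidean norm). -/
abbrev Ball (m : ℕ) : Type := Metric.ball (0 : EuclideanSpace ℂ (Fin m)) 1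

/-- The `𝓛(E)`-valued kernel `K(z, w) = (1 - ∑ i, z i * conj (w i))⁻¹ • 1` on the ball. -/
def kern (m : ℕ) (E : Type*) [NormedAddCommGroup E] [InnerProductSpace ℂ E] :
    Matrix (Ball m) (Ball m) (E →L[ℂ] E) :=
  Matrix.of fun z w =>
    (1 - ∑ i, z.1 i * (starRingEnd ℂ) (w.1 i))⁻¹ • ContinuousLinearMap.id ℂ E

theorem sum_eq_inner {m : ℕ} (z w : EuclideanSpace ℂ (Fin m)) :
    ∑ i, z i * (starRingEnd ℂ) (w i) = inner ℂ w z := by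
  simp [PiLp.inner_apply]

theorem norm_inner_ball_lt {m : ℕ} (z w : Ball m) : ‖inner ℂ w.1 z.1‖ < 1 := by
  have hz : ‖z.1‖ < 1 := mem_ball_zero_iff.mp z.2
  have hw : ‖w.1‖ < 1 := mem_ball_zero_iff.mp w.2
  calc ‖inner ℂ w.1 z.1‖ ≤ ‖w.1‖ * ‖z.1‖ := norm_inner_le_norm _ _
    _ < 1 := by nlinarith [norm_nonneg z.1, norm_nonneg w.1]

theorem pow_kernel_nonneg {m : ℕ} {E : Type*} [NormedAddCommGroup E] [InnerProductSpace ℂ E]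
    (s : Finset (Ball m)) (n : ℕ) : ∀ v : Ball m → E,
    0 ≤ (∑ x ∈ s, ∑ y ∈ s, inner ℂ y.1 x.1 ^ n * inner ℂ (v x) (v y)).re := by
  induction n with
  | zero =>
    intro v
    have h : (∑ x ∈ s, ∑ y ∈ s, inner ℂ y.1 x.1 ^ 0 * inner ℂ (v x) (v y))
        = inner ℂ (∑ x ∈ s, v x) (∑ x ∈ s, v x) := by
      simp only [pow_zero, one_mul, sum_inner, inner_sum]
      exact Finset.sum_comm
    rw [h]
    exact inner_self_nonneg (𝕜 := ℂ)
  | succ n ih =>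
    intro v
    have h : (∑ x ∈ s, ∑ y ∈ s, inner ℂ y.1 x.1 ^ (n + 1) * inner ℂ (v x) (v y))
        = ∑ i, ∑ x ∈ s, ∑ y ∈ s, inner ℂ y.1 x.1 ^ n *
            inner ℂ ((starRingEnd ℂ) (x.1 i) • v x) ((starRingEnd ℂ) (y.1 i) • v y) := by
      rw [Finset.sum_comm (s := Finset.univ)]
      refine Finset.sum_congr rfl fun x _ => ?_
      rw [Finset.sum_comm (s := Finset.univ)]
      refine Finset.sum_congr rfl fun y _ => ?_
      rw [← Finset.mul_sum, pow_succ, mul_assoc]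
      congr 1
      rw [← sum_eq_inner, Finset.sum_mul]
      refine Finset.sum_congr rfl fun i _ => ?_
      rw [inner_smul_left, inner_smul_right]
      simp
      ring
    rw [h, Complex.re_sum]
    exact Finset.sum_nonneg fun i _ => ih _

theorem kern_posSemidef (m : ℕ) (E : Type*) [NormedAddCommGroup E] [InnerProductSpace ℂ E]
    [CompleteSpace E] : (kern m E).PosSemidef := by
  have hiff : (kern m E).PosSemidef ↔ ((kern m E).IsHermitian ∧ ∀ vv : Ball m →₀ E,
      0 ≤ RCLike.re (vv.sum fun x w => vv.sum fun x' w' => inner ℂ (kern m E x' x w) w')) :=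
    (RKHS.posSemidef_tfae (K := kern m E)).out 0 2
  refine hiff.mpr (And.intro ?_ fun vv => ?_)
  · refine Matrix.ext fun x y => ?_
    refine ContinuousLinearMap.ext fun v => ?_
    refine ext_inner_right ℂ fun w => ?_
    simp only [Matrix.conjTranspose_apply, ContinuousLinearMap.star_eq_adjoint,
      ContinuousLinearMap.adjoint_inner_left, kern, Matrix.of_apply, sum_eq_inner]
    simp [inner_smul_left, inner_smul_right]
  · have key : HasSum (fun n : ℕ => ∑ x ∈ vv.support, ∑ y ∈ vv.support,
        inner ℂ y.1 x.1 ^ n * inner ℂ (vv x) (vv y))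
        (vv.sum fun x w => vv.sum fun x' w' => inner ℂ (kern m E x' x w) w') := by
      refine hasSum_sum fun x _ => hasSum_sum fun y _ => ?_
      have := (hasSum_geometric_of_norm_lt_one (norm_inner_ball_lt x y)).mul_right
        (inner ℂ (vv x) (vv y))
      have h : inner ℂ (kern m E y x (vv x)) (vv y)
          = (1 - inner ℂ y.1 x.1)⁻¹ * inner ℂ (vv x) (vv y) := by
        simp [kern, sum_eq_inner, mul_comm]
      rw [← h] at this
      exact this
    exact (Complex.hasSum_re key).nonneg fun n => pow_kernel_nonneg _ n _

instance (m : ℕ) (E : Type*) [NormedAddCommGroup E] [InnerProductSpace ℂ E]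
    [CompleteSpace E] : Fact (kern m E).PosSemidef := ⟨kern_posSemidef m E⟩

/-- The `E`-valued Drury–Arveson space `H²_m ⊗ E = H²_m(E)`: the Hilbert space of `E`-valued
functions on the ball with reproducing kernel `(z, w) ↦ (1 - ∑ i, z i * conj (w i))⁻¹ • 1`.
An element `f` is applied to a point `z` of the ball as `f z`. -/
abbrev H2 (m : ℕ) (E : Type*) [NormedAddCommGroup E] [InnerProductSpace ℂ E]
    [CompleteSpace E] : Type _ := RKHS.OfKernel (kern m E)

/-- A function on the ball is holomorphic if it is complex differentiable at every point
(as a function on an open subset of `ℂ^m`). -/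
def IsHolomorphic {m : ℕ} {V : Type*} [NormedAddCommGroup V] [NormedSpace ℂ V]
    (φ : Ball m → V) : Prop :=
  ∃ g : EuclideanSpace ℂ (Fin m) → V,
    DifferentiableOn ℂ g (Metric.ball 0 1) ∧ ∀ z : Ball m, g z.1 = φ z

/-- `𝓜(E, F)`: holomorphic `φ : 𝔹^m → 𝓛(E, F)` such that `φ f ∈ H²_m(F)` for all `f ∈ H²_m(E)`. -/
def multipliers (m : ℕ) (E F : Type*)
    [NormedAddCommGroup E] [InnerProductSpace ℂ E] [CompleteSpace E]
    [NormedAddCommGroup F] [InnerProductSpace ℂ F] [CompleteSpace F] :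
    Set (Ball m → (E →L[ℂ] F)) :=
  {φ | IsHolomorphic φ ∧ ∀ f : H2 m E, ∃ g : H2 m F, ∀ z, g z = φ z (f z)}

section

variable {m : ℕ} {E F : Type*}
    [NormedAddCommGroup E] [InnerProductSpace ℂ E] [CompleteSpace E]
    [NormedAddCommGroup F] [InnerProductSpace ℂ F] [CompleteSpace F]

/-- Multiplication by a multiplier, as a linear map. -/
def mulLin (φ : Ball m → (E →L[ℂ] F)) (hφ : φ ∈ multipliers m E F) : H2 m E →ₗ[ℂ] H2 m F where
  toFun f := (hφ.2 f).choose
  map_add' f g := RKHS.ext fun z => by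
    rw [(hφ.2 (f + g)).choose_spec z]
    simp only [RKHS.coe_add, Pi.add_apply, map_add]
    rw [(hφ.2 f).choose_spec z, (hφ.2 g).choose_spec z]
  map_smul' c f := RKHS.ext fun z => by
    rw [(hφ.2 (c • f)).choose_spec z]
    simp only [RKHS.coe_smul, Pi.smul_apply, map_smul, RingHom.id_apply]
    rw [(hφ.2 f).choose_spec z]

theorem mulLin_apply (φ : Ball m → (E →L[ℂ] F)) (hφ : φ ∈ multipliers m E F) (f : H2 m E)
    (z : Ball m) : mulLin φ hφ f z = φ z (f z) :=
  (hφ.2 f).choose_spec z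

/-- The multiplication operator `M_φ : H²_m(E) → H²_m(F)`, `M_φ f = φ f`, of a multiplier; it is
bounded by the closed graph theorem. -/
def mulOp (φ : Ball m → (E →L[ℂ] F)) (hφ : φ ∈ multipliers m E F) : H2 m E →L[ℂ] H2 m F where
  toLinearMap := mulLin φ hφ
  cont := by
    refine (mulLin φ hφ).continuous_of_seq_closed_graph fun u x y hu hy => ?_
    refine RKHS.ext fun z => ?_
    have h1 := ((RKHS.continuous_eval (H := H2 m F) z).tendsto y).comp hy
    have h2 := (((φ z).continuous.comp (RKHS.continuous_eval (H := H2 m E) z)).tendsto x).comp hu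
    rw [mulLin_apply]
    refine tendsto_nhds_unique h1 (h2.congr fun n => ?_)
    simp [mulLin_apply]

theorem mulOp_apply (φ : Ball m → (E →L[ℂ] F)) (hφ : φ ∈ multipliers m E F) (f : H2 m E)
    (z : Ball m) : mulOp φ hφ f z = φ z (f z) :=
  mulLin_apply φ hφ f z

end

/-- A partial isometry: a bounded operator that is isometric on the orthogonal complement of its
kernel. -/
def IsPartialIsometry {H K : Type*} [NormedAddCommGroup H] [InnerProductSpace ℂ H]
    [NormedAddCommGroup K] [InnerProductSpace ℂ K] (T : H →L[ℂ] K) : Prop :=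
  ∀ f ∈ T.kerᗮ, ‖T f‖ = ‖f‖

end DruryArveson

end

/-!
The substance of the theorem is that range inclusion produces a multiplier `ψ` with `φ = θ ψ`; the
argument is the lurking isometry proof of Leech's theorem, which rests on the special form
`1 / (1 - ⟨z, w⟩)` of the Drury–Arveson kernel.

Range inclusion gives, by the closed graph theorem, a bounded operator `T` with `M_θ T = M_φ`
(`exists_comp_eq_of_range_subset`). Hence `M_φ† = T† M_θ†`, and writing `c² - T T† = s† s`
(`exists_defect`) and evaluating on kernel functions, where `M_θ† k_w v = k_w θ(w)† v`
(`adjoint_mulOp_kerFun`), one gets vectors `γ(w, v) = s k_w θ(w)† v` with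
`c² ⟨θ(w)† v, θ(w')† v'⟩ + ⟨w', w⟩ ⟨γ, γ'⟩ = ⟨φ(w)† v, φ(w')† v'⟩ + ⟨γ, γ'⟩`.
This says that the vectors `(c θ(w)† v, w† γ)` of `E ⊕ K^m` and `(φ(w)† v, γ)` of `F ⊕ K` have the
same Gram matrix, where `w† k = (conj (w i) k)_i`. So some partial isometry `W` maps the former to
the latter (`exists_partialIsometry_of_inner_eq`). Eliminating `γ` from the two components of this
equation (`inner_transfer_adjoint`) gives `φ(w)† = c ψ₀(w)† θ(w)†` for the transfer function `ψ₀` of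
the adjoint of `W`, so `ψ = c ψ₀` solves `φ = θ ψ` pointwise.

It remains to see that transfer functions of contractions are multipliers
(`transfer_mem_multipliers`). They are visibly holomorphic, and the equation
`W (e, w† g) = (ψ₀(w)† e, g)` makes `k_w e ↦ k_w ψ₀(w)† e` a contraction on the span of the kernel
functions; its adjoint is multiplication by `ψ₀`.
-/

namespace DruryArveson

open ContinuousLinearMap Filter
open scoped InnerProduct
open WithLp (toLp)

/-! ### Hilbert space operators -/

section Operators

variable {H₁ H₂ H₃ : Type*}
  [NormedAddCommGroup H₁] [InnerProductSpace ℂ H₁] [CompleteSpace H₁]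
  [NormedAddCommGroup H₂] [InnerProductSpace ℂ H₂] [CompleteSpace H₂]
  [NormedAddCommGroup H₃] [InnerProductSpace ℂ H₃]

/-- **Douglas factorization**: range inclusion lets one operator be divided by another. The
quotient sends `x` to the solution `y` of `A y = B x` orthogonal to `ker A`. -/
theorem exists_comp_eq_of_range_subset (A : H₁ →L[ℂ] H₃) (B : H₂ →L[ℂ] H₃)
    (h : Set.range B ⊆ Set.range A) : ∃ T : H₂ →L[ℂ] H₁, ∀ x, A (T x) = B x := by
  have hker : IsClosed (A.ker : Set H₁) := A.isClosed_ker
  have : CompleteSpace A.ker := hker.completeSpace_coe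
  have hex : ∀ x, ∃ y ∈ A.kerᗮ, A y = B x := by
    intro x
    obtain ⟨y, hy⟩ := h ⟨x, rfl⟩
    refine ⟨y - A.ker.starProjection y, Submodule.sub_starProjection_mem_orthogonal y, ?_⟩
    have h0 : A (A.ker.starProjection y) = 0 := (A.ker.starProjection_apply_mem y)
    rw [map_sub, h0, sub_zero, hy]
  have huniq : ∀ y ∈ A.kerᗮ, ∀ y' ∈ A.kerᗮ, A y = A y' → y = y' := by
    intro y hy y' hy' he
    have h1 : y - y' ∈ A.ker := by
      change A (y - y') = 0
      rw [map_sub, he, sub_self]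
    have h2 : y - y' ∈ A.kerᗮ := sub_mem hy hy'
    exact sub_eq_zero.mp (inner_self_eq_zero.mp (Submodule.inner_right_of_mem_orthogonal h1 h2))
  choose t ht hAt using hex
  let T : H₂ →ₗ[ℂ] H₁ :=
    { toFun := t
      map_add' := fun x y => huniq _ (ht _) _ (add_mem (ht _) (ht _)) (by simp [hAt])
      map_smul' := fun c x =>
        huniq _ (ht _) _ (Submodule.smul_mem _ _ (ht _)) (by simp [hAt]) }
  refine ⟨⟨T, T.continuous_of_seq_closed_graph fun u x y hu hy => ?_⟩, hAt⟩
  have hy' : Tendsto (fun n => A (t (u n))) atTop (nhds (A y)) := (A.continuous.tendsto y).comp hy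
  simp only [hAt] at hy'
  refine huniq _ ?_ _ (ht x) ?_
  · exact A.ker.isClosed_orthogonal.mem_of_tendsto hy (Eventually.of_forall fun n => ht (u n))
  · change A y = A (t x)
    rw [hAt]
    exact tendsto_nhds_unique hy' ((B.continuous.tendsto x).comp hu)

/-- The defect operator of `T†` at level `c = ‖T T†‖^(1/2)`: an operator `s` with
`s† s = c² - T T†`, an identity recorded here through inner products. -/
theorem exists_defect (T : H₂ →L[ℂ] H₁) : ∃ (c : ℝ) (s : H₁ →L[ℂ] H₁), ∀ x y,
    inner ℂ ((c : ℂ) • x) ((c : ℂ) • y) = inner ℂ ((T†) x) ((T†) y) + inner ℂ (s x) (s y) := by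
  have hsa : IsSelfAdjoint (T ∘L T†) := by
    rw [isSelfAdjoint_iff', adjoint_comp, adjoint_adjoint]
  have hle := sub_nonneg.mpr hsa.le_algebraMap_norm_self
  obtain ⟨s, hs⟩ := CStarAlgebra.nonneg_iff_eq_star_mul_self.mp hle
  refine ⟨√‖T ∘L T†‖, s, fun x y => ?_⟩
  have h1 : inner ℂ x ((star s * s) y) = inner ℂ (s x) (s y) := by
    change inner ℂ x ((s†) (s y)) = _
    rw [adjoint_inner_right]
  have h2 : inner ℂ x ((T ∘L T†) y) = inner ℂ ((T†) x) ((T†) y) := by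
    rw [comp_apply, adjoint_inner_left]
  have h3 : ((√‖T ∘L T†‖ : ℝ) : ℂ) * (√‖T ∘L T†‖ : ℝ) = (‖T ∘L T†‖ : ℝ) := by
    rw [← Complex.ofReal_mul, Real.mul_self_sqrt (norm_nonneg _)]
  rw [← h1, ← hs, ← h2, ← inner_add_right, inner_smul_left, inner_smul_right, Complex.conj_ofReal,
    ← mul_assoc, h3, ← inner_smul_right]
  congr 1
  simp [Algebra.algebraMap_eq_smul_one]

/-- **Lurking isometry**: two families with the same Gram matrix are matched by a partial isometry
`W`, and `P` is the orthogonal projection onto its kernel. -/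
theorem exists_partialIsometry_of_inner_eq {κ : Type*} (a : κ → H₁) (b : κ → H₂)
    (hab : ∀ i j, inner ℂ (a i) (a j) = inner ℂ (b i) (b j)) :
    ∃ (W : H₁ →L[ℂ] H₂) (P : H₁ →L[ℂ] H₁), (∀ i, W (a i) = b i) ∧
      ∀ x y, inner ℂ x y = inner ℂ (W x) (W y) + inner ℂ (P x) (P y) := by
  let α := Finsupp.linearCombination ℂ a
  let β := Finsupp.linearCombination ℂ b
  have hαβ : ∀ x y, inner ℂ (α x) (α y) = inner ℂ (β x) (β y) := by
    intro x y
    simp only [α, β, Finsupp.linearCombination_apply, Finsupp.sum, sum_inner, inner_sum,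
      inner_smul_left, inner_smul_right, hab]
  have hnorm : ∀ x, ‖β x‖ = ‖α x‖ := by
    intro x
    rw [@norm_eq_sqrt_re_inner ℂ, @norm_eq_sqrt_re_inner ℂ, hαβ]
  let M := (LinearMap.range α).topologicalClosure
  have : CompleteSpace M := (LinearMap.range α).isClosed_topologicalClosure.completeSpace_coe
  let e : (κ →₀ ℂ) →ₗ[ℂ] M :=
    α.codRestrict M fun x => Submodule.le_topologicalClosure _ ⟨x, rfl⟩
  have he : DenseRange e := by
    intro y
    rw [Metric.mem_closure_iff]
    intro ε hε
    obtain ⟨_, ⟨x, rfl⟩, hx⟩ := Metric.mem_closure_iff.mp y.2 ε hε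
    exact ⟨e x, ⟨x, rfl⟩, hx⟩
  let V : M →L[ℂ] H₂ := β.extendOfNorm e
  have hV : ∀ x, V (e x) = β x := fun x =>
    LinearMap.extendOfNorm_eq he ⟨1, fun x => by rw [one_mul, hnorm]; rfl⟩ x
  have hVn : ∀ y, ‖V y‖ = ‖y‖ := by
    intro y
    refine he.induction_on (p := fun y => ‖V y‖ = ‖y‖) y
      (isClosed_eq (by fun_prop) (by fun_prop)) fun x => ?_
    rw [hV, hnorm]
    rfl
  let V' : M →ₗᵢ[ℂ] H₂ := ⟨V, hVn⟩
  refine ⟨V ∘L M.orthogonalProjectionOnto, Mᗮ.starProjection, fun i => ?_, fun x y => ?_⟩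
  · have h1 : a i = (e (Finsupp.single i 1) : M) := by simp [e, α]
    rw [comp_apply, h1, Submodule.orthogonalProjectionOnto_mem_subspace_eq_self, hV]
    simp [β]
  · have h1 : inner ℂ (V (M.orthogonalProjectionOnto x)) (V (M.orthogonalProjectionOnto y))
        = inner ℂ (M.starProjection x) (M.starProjection y) := V'.inner_map_map _ _
    have hx := M.starProjection_add_starProjection_orthogonal x
    have hy := M.starProjection_add_starProjection_orthogonal y
    rw [comp_apply, comp_apply, h1]
    conv_lhs => rw [← hx, ← hy]
    rw [inner_add_left, inner_add_right, inner_add_right,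
      Submodule.inner_right_of_mem_orthogonal (M.starProjection_apply_mem x)
        (Mᗮ.starProjection_apply_mem y),
      Submodule.inner_left_of_mem_orthogonal (M.starProjection_apply_mem y)
        (Mᗮ.starProjection_apply_mem x)]
    ring

end Operators

/-! ### Kernel functions -/

section KernelFunctions

variable {m : ℕ} {E : Type*} [NormedAddCommGroup E] [InnerProductSpace ℂ E] [CompleteSpace E]

theorem one_sub_inner_ne_zero (z w : Ball m) : 1 - inner ℂ w.1 z.1 ≠ 0 := by
  intro h
  have h1 := norm_inner_ball_lt z w
  rw [← sub_eq_zero.mp h, norm_one] at h1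
  exact lt_irrefl _ h1

theorem inner_kerFun_kerFun (z w : Ball m) (e e' : E) :
    inner ℂ (RKHS.kerFun (H2 m E) z e) (RKHS.kerFun (H2 m E) w e') =
      (1 - inner ℂ w.1 z.1)⁻¹ * inner ℂ e e' := by
  rw [← RKHS.kernel_inner, RKHS.OfKernel.kernel_ofKernel]
  simp [kern, sum_eq_inner, inner_smul_left]

end KernelFunctions

/-! ### Transfer functions of contractions -/

section TransferFunction

variable {m : ℕ} {E F K : Type*} [NormedAddCommGroup E] [InnerProductSpace ℂ E]
  [NormedAddCommGroup F] [InnerProductSpace ℂ F] [NormedAddCommGroup K] [InnerProductSpace ℂ K]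

/-- The row operator `(e, k) ↦ ∑ i, z i • k i` on `E ⊕ K^m`. -/
noncomputable def row (E K : Type*) [NormedAddCommGroup E] [InnerProductSpace ℂ E]
    [NormedAddCommGroup K] [InnerProductSpace ℂ K] (z : EuclideanSpace ℂ (Fin m)) :
    WithLp 2 (E × PiLp 2 fun _ : Fin m => K) →L[ℂ] K :=
  ∑ i, z i • (PiLp.proj 2 (fun _ : Fin m => K) i ∘L WithLp.sndL 2 ℂ E _)

theorem row_apply (z : EuclideanSpace ℂ (Fin m))
    (y : WithLp 2 (E × PiLp 2 fun _ : Fin m => K)) : row E K z y = ∑ i, z i • y.snd i := by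
  simp [row, sum_apply]

variable (L : WithLp 2 (F × K) →L[ℂ] WithLp 2 (E × PiLp 2 fun _ : Fin m => K))

/-- The feedback operator `z D` of the system `L = (A, B; C, D) : F ⊕ K → E ⊕ K^m`, where `z` acts
on `K^m` as the row operator. -/
noncomputable def feedback (z : EuclideanSpace ℂ (Fin m)) : K →L[ℂ] K :=
  row E K z ∘L L ∘L (WithLp.prodContinuousLinearEquiv 2 ℂ F K).symm.toContinuousLinearMap ∘L
    .inr ℂ F K

/-- The state `(1 - z D)⁻¹ z C` of the system `L = (A, B; C, D)` at the point `z`. The inverse is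
`Ring.inverse`, hence meaningful only where `1 - z D` is invertible. -/
noncomputable def state (z : EuclideanSpace ℂ (Fin m)) : F →L[ℂ] K :=
  Ring.inverse (1 - feedback L z) ∘L row E K z ∘L L ∘L
    (WithLp.prodContinuousLinearEquiv 2 ℂ F K).symm.toContinuousLinearMap ∘L .inl ℂ F K

/-- The transfer function `z ↦ A + B (1 - z D)⁻¹ z C` of the system
`L = (A, B; C, D) : F ⊕ K → E ⊕ K^m`. -/
noncomputable def transfer (z : EuclideanSpace ℂ (Fin m)) : F →L[ℂ] E :=
  WithLp.fstL 2 ℂ E _ ∘L L ∘L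
    (WithLp.prodContinuousLinearEquiv 2 ℂ F K).symm.toContinuousLinearMap ∘L
      (ContinuousLinearMap.id ℂ F).prod (state L z)

variable {L}

theorem feedback_apply (z : EuclideanSpace ℂ (Fin m)) (k : K) :
    feedback L z k = row E K z (L (toLp 2 (0, k))) := rfl

theorem state_apply (z : EuclideanSpace ℂ (Fin m)) (f : F) :
    state L z f = Ring.inverse (1 - feedback L z) (row E K z (L (toLp 2 (f, 0)))) := rfl

theorem transfer_apply (z : EuclideanSpace ℂ (Fin m)) (f : F) :
    transfer L z f = (L (toLp 2 (f, state L z f))).fst := rfl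

theorem differentiable_sum_smul {V : Type*} [NormedAddCommGroup V] [NormedSpace ℂ V]
    (M : Fin m → V) : Differentiable ℂ fun z : EuclideanSpace ℂ (Fin m) => ∑ i, z i • M i :=
  Differentiable.fun_sum fun i _ =>
    (EuclideanSpace.proj i : EuclideanSpace ℂ (Fin m) →L[ℂ] ℂ).differentiable.smul_const (M i)

theorem inner_toLp_toLp (e e' : E) (f f' : F) :
    inner ℂ (toLp 2 (e, f)) (toLp 2 (e', f')) = inner ℂ e e' + inner ℂ f f' :=
  WithLp.prod_inner_apply _ _

theorem toLp_add_right {F K : Type*} [NormedAddCommGroup F] [NormedAddCommGroup K] (f : F) (k : K) :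
    toLp 2 (f, k) = toLp 2 (f, (0 : K)) + toLp 2 ((0 : F), k) := by
  rw [← WithLp.toLp_add, Prod.mk_add_mk, add_zero, zero_add]

variable [CompleteSpace E] [CompleteSpace K]

theorem adjoint_row_apply (z : EuclideanSpace ℂ (Fin m)) (k : K) :
    ((row E K z)†) k = toLp 2 (0, toLp 2 fun i => (starRingEnd ℂ) (z i) • k) := by
  refine ext_inner_right ℂ fun y => ?_
  rw [adjoint_inner_left, row_apply, inner_sum, WithLp.prod_inner_apply, PiLp.inner_apply]
  simp [inner_smul_left, inner_smul_right]

theorem inner_adjoint_row (z w : EuclideanSpace ℂ (Fin m)) (k l : K) :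
    inner ℂ (((row E K z)†) k) (((row E K w)†) l) = inner ℂ w z * inner ℂ k l := by
  rw [adjoint_inner_left, adjoint_row_apply, row_apply]
  change inner ℂ k (∑ i, z i • (starRingEnd ℂ) (w i) • l) = _
  simp only [smul_smul, ← Finset.sum_smul, sum_eq_inner, inner_smul_right]

theorem inner_toLp_add_adjoint_row (z w : EuclideanSpace ℂ (Fin m)) (u v : E) (k l : K) :
    inner ℂ (toLp 2 (u, 0) + ((row E K z)†) k) (toLp 2 (v, 0) + ((row E K w)†) l) =
      inner ℂ u v + inner ℂ w z * inner ℂ k l := by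
  rw [← inner_adjoint_row (E := E), adjoint_row_apply, adjoint_row_apply, ← WithLp.toLp_add,
    ← WithLp.toLp_add, Prod.mk_add_mk, Prod.mk_add_mk, inner_toLp_toLp, inner_toLp_toLp]
  simp

theorem norm_row_le (z : EuclideanSpace ℂ (Fin m)) : ‖row E K z‖ ≤ ‖z‖ := by
  rw [← ContinuousLinearMap.adjoint.norm_map (row E K z)]
  refine opNorm_le_bound _ (norm_nonneg _) fun k => le_of_eq ?_
  have h := inner_adjoint_row (E := E) z z k k
  rw [inner_self_eq_norm_sq_to_K, inner_self_eq_norm_sq_to_K, inner_self_eq_norm_sq_to_K] at h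
  refine (sq_eq_sq₀ (norm_nonneg _) (by positivity)).mp ?_
  rw [mul_pow]
  exact_mod_cast h

theorem isUnit_one_sub_feedback (hL : ‖L‖ ≤ 1) {z : EuclideanSpace ℂ (Fin m)} (hz : ‖z‖ < 1) :
    IsUnit (1 - feedback L z) := by
  refine isUnit_one_sub_of_norm_lt_one (lt_of_le_of_lt ?_ hz)
  refine opNorm_le_bound _ (norm_nonneg _) fun k => ?_
  have hk : ‖toLp 2 ((0 : F), k)‖ = ‖k‖ := congrArg NNReal.toReal (WithLp.nnnorm_toLp_inr 2 F K k)
  calc ‖feedback L z k‖ ≤ ‖row E K z‖ * ‖L (toLp 2 ((0 : F), k))‖ :=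
        (row E K z).le_opNorm _
    _ ≤ ‖z‖ * (1 * ‖toLp 2 ((0 : F), k)‖) := by
      gcongr
      · exact norm_row_le z
      · exact L.le_of_opNorm_le hL _
    _ = ‖z‖ * ‖k‖ := by rw [one_mul, hk]

/-- The state `k` solves the feedback equation `k = z (C f + D k)`. -/
theorem row_state (hL : ‖L‖ ≤ 1) {z : EuclideanSpace ℂ (Fin m)} (hz : ‖z‖ < 1) (f : F) :
    row E K z (L (toLp 2 (f, state L z f))) = state L z f := by
  have h := DFunLike.congr_fun (Ring.mul_inverse_cancel _ (isUnit_one_sub_feedback hL hz))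
    (row E K z (L (toLp 2 (f, 0))))
  change state L z f - row E K z (L (toLp 2 (0, state L z f))) =
    row E K z (L (toLp 2 (f, 0))) at h
  rw [toLp_add_right, map_add, map_add, ← h, sub_add_cancel]

theorem differentiableAt_transfer (hL : ‖L‖ ≤ 1) {z : EuclideanSpace ℂ (Fin m)} (hz : ‖z‖ < 1) :
    DifferentiableAt ℂ (transfer L) z := by
  have hrow : Differentiable ℂ (row E K : EuclideanSpace ℂ (Fin m) → _) :=
    differentiable_sum_smul (V := WithLp 2 (E × PiLp 2 fun _ : Fin m => K) →L[ℂ] K)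
      fun i => PiLp.proj 2 (fun _ : Fin m => K) i ∘L WithLp.sndL 2 ℂ E _
  have hfb : Differentiable ℂ (feedback L) := by
    unfold feedback
    fun_prop
  have hinv : DifferentiableAt ℂ (fun z => Ring.inverse (1 - feedback L z)) z :=
    DifferentiableAt.comp (g := Ring.inverse) z
      (differentiableAt_inverse (isUnit_one_sub_feedback hL hz)) ((hfb z).const_sub 1)
  have hst : DifferentiableAt ℂ (state L) z := by
    unfold state
    fun_prop
  have htr : transfer L = fun z => (WithLp.fstL 2 ℂ E _ ∘L L ∘L
      (WithLp.prodContinuousLinearEquiv 2 ℂ F K).symm.toContinuousLinearMap) ∘L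
        (.inl ℂ F K + .inr ℂ F K ∘L state L z) := by
    funext z
    refine ContinuousLinearMap.ext fun f => ?_
    change (L (toLp 2 (f, state L z f))).fst = (L (toLp 2 (f + 0, 0 + state L z f))).fst
    rw [add_zero, zero_add]
  rw [htr]
  fun_prop

variable [CompleteSpace F] {W : WithLp 2 (E × PiLp 2 fun _ : Fin m => K) →L[ℂ] WithLp 2 (F × K)}

/-- If `W` carries `(u, z† g)` to `(v, g)`, so that the state `g` reproduces itself, then `v` is
the value at `u` of the adjoint of the transfer function of `W†`. -/
theorem inner_transfer_adjoint (hW : ‖W‖ ≤ 1) {z : EuclideanSpace ℂ (Fin m)} (hz : ‖z‖ < 1)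
    {u : E} {g : K} {v : F} (h : W (toLp 2 (u, 0) + ((row E K z)†) g) = toLp 2 (v, g)) (f : F) :
    inner ℂ v f = inner ℂ u (transfer (W†) z f) := by
  have hL : ‖W†‖ ≤ 1 := by rwa [ContinuousLinearMap.adjoint.norm_map]
  have h1 := congrArg (fun x => inner ℂ x (toLp 2 (f, state (W†) z f))) h
  rw [← adjoint_inner_right, inner_add_left, adjoint_inner_left, row_state hL hz,
    WithLp.prod_inner_apply, WithLp.prod_inner_apply] at h1
  simp only [inner_zero_left, add_zero] at h1
  exact (add_right_cancel h1).symm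

/-- Every vector `u` is the first component of a self-reproducing input of `W`. -/
theorem exists_apply_eq_adjoint_transfer (hW : ‖W‖ ≤ 1) {z : EuclideanSpace ℂ (Fin m)}
    (hz : ‖z‖ < 1) (u : E) : ∃ g : K, W (toLp 2 (u, 0) + ((row E K z)†) g) =
      toLp 2 (((transfer (W†) z)†) u, g) := by
  have hL : ‖W†‖ ≤ 1 := by rwa [ContinuousLinearMap.adjoint.norm_map]
  let B : K →L[ℂ] E := WithLp.fstL 2 ℂ E _ ∘L W† ∘L
    (WithLp.prodContinuousLinearEquiv 2 ℂ F K).symm.toContinuousLinearMap ∘L .inr ℂ F K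
  have hB : ∀ k, B k = ((W†) (toLp 2 (0, k))).fst := fun k => rfl
  let R : K →L[ℂ] K := Ring.inverse (1 - feedback (W†) z)
  have hR : ∀ k, R (feedback (W†) z k) = R k - k := by
    intro k
    have h := DFunLike.congr_fun (Ring.inverse_mul_cancel _ (isUnit_one_sub_feedback hL hz)) k
    change R (k - feedback (W†) z k) = k at h
    rw [map_sub] at h
    rw [eq_sub_iff_add_eq, ← eq_sub_iff_add_eq', h]
  -- The state is determined by the second component of the equation: it is the image of `u` under
  -- the adjoint of `B (1 - z D)⁻¹`.
  refine ⟨((B ∘L R)†) u, ext_inner_right ℂ fun y => ?_⟩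
  obtain ⟨f, k⟩ := y
  rw [← adjoint_inner_right, inner_add_left, adjoint_inner_left, adjoint_inner_left,
    WithLp.prod_inner_apply, WithLp.prod_inner_apply]
  have h1 : ((W†) (toLp 2 (f, k))).fst + B (R (row E K z ((W†) (toLp 2 (f, k))))) =
      transfer (W†) z f + B (R k) := by
    have h2 : R (row E K z ((W†) (toLp 2 (f, 0)))) = state (W†) z f := rfl
    rw [transfer_apply, toLp_add_right f k, toLp_add_right f (state _ _ _), (W†).map_add,
      (W†).map_add, WithLp.add_fst, WithLp.add_fst, (row E K z).map_add, R.map_add, B.map_add,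
      ← hB, ← hB, ← feedback_apply, hR, h2, B.map_sub]
    abel
  simp only [inner_zero_left, add_zero]
  rw [adjoint_inner_left, adjoint_inner_left, ← inner_add_right, ← inner_add_right]
  exact congrArg _ h1

/-- The realization formula: the transfer function of the adjoint of a contraction `W` with
defect operator `P` is a multiplier. The Gram matrix of the kernel functions `k_w e` splits as that
of `k_w ψ(w)† e`, of `k_w P x` and of `g`, where `W x = (ψ(w)† e, g)` as in
`exists_apply_eq_adjoint_transfer`; hence `k_w e ↦ k_w ψ(w)† e` extends to a bounded operator,
whose adjoint is multiplication by `ψ`. -/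
theorem transfer_mem_multipliers
    {P : WithLp 2 (E × PiLp 2 fun _ : Fin m => K) →L[ℂ] WithLp 2 (E × PiLp 2 fun _ : Fin m => K)}
    (hW : ‖W‖ ≤ 1) (hP : ∀ x y, inner ℂ x y = inner ℂ (W x) (W y) + inner ℂ (P x) (P y)) :
    (fun z : Ball m => transfer (W†) z.1) ∈ multipliers m F E := by
  have hL : ‖W†‖ ≤ 1 := by rwa [ContinuousLinearMap.adjoint.norm_map]
  refine ⟨⟨transfer (W†), fun z hz => (differentiableAt_transfer hL
    (mem_ball_zero_iff.mp hz)).differentiableWithinAt, fun z => rfl⟩, fun f => ?_⟩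
  choose g hg using fun z : Ball m =>
    exists_apply_eq_adjoint_transfer hW (mem_ball_zero_iff.mp z.2)
  let x : Ball m × E → WithLp 2 (E × PiLp 2 fun _ : Fin m => K) :=
    fun p => toLp 2 (p.2, 0) + ((row E K p.1.1)†) (g p.1 p.2)
  let b : Ball m × E →
      WithLp 2 (H2 m F × WithLp 2 (H2 m (WithLp 2 (E × PiLp 2 fun _ : Fin m => K)) × K)) :=
    fun p => toLp 2 (RKHS.kerFun (H2 m F) p.1 (((transfer (W†) p.1.1)†) p.2),
      toLp 2 (RKHS.kerFun _ p.1 (P (x p)), g p.1 p.2))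
  obtain ⟨V, -, hV, -⟩ := exists_partialIsometry_of_inner_eq
    (fun p : Ball m × E => RKHS.kerFun (H2 m E) p.1 p.2) b (by
      rintro ⟨w, e⟩ ⟨w', e'⟩
      have h1 := hP (x (w, e)) (x (w', e'))
      have h2 : inner ℂ (x (w, e)) (x (w', e')) =
          inner ℂ e e' + inner ℂ w'.1 w.1 * inner ℂ (g w e) (g w' e') :=
        inner_toLp_add_adjoint_row _ _ _ _ _ _
      have h3 : 1 - inner ℂ w'.1 w.1 ≠ 0 := one_sub_inner_ne_zero w w'
      rw [h2, hg, hg, inner_toLp_toLp] at h1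
      simp only [b, inner_toLp_toLp, inner_kerFun_kerFun]
      field_simp
      linear_combination h1)
  let T : H2 m E →L[ℂ] H2 m F := WithLp.fstL 2 ℂ _ _ ∘L V
  have hT : ∀ w e, T (RKHS.kerFun (H2 m E) w e) =
      RKHS.kerFun (H2 m F) w (((transfer (W†) w.1)†) e) := fun w e =>
    congrArg (fun y => y.fst) (hV (w, e))
  refine ⟨(T†) f, fun w => ext_inner_left ℂ fun e => ?_⟩
  rw [← RKHS.kerFun_inner, adjoint_inner_right, hT, RKHS.kerFun_inner, adjoint_inner_left]

end TransferFunction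

/-! ### Multipliers -/

section Multipliers

variable {m : ℕ} {E F G : Type*}
  [NormedAddCommGroup E] [InnerProductSpace ℂ E] [CompleteSpace E]
  [NormedAddCommGroup F] [InnerProductSpace ℂ F] [CompleteSpace F]
  [NormedAddCommGroup G] [InnerProductSpace ℂ G] [CompleteSpace G]

theorem adjoint_mulOp_kerFun {φ : Ball m → (E →L[ℂ] F)} (hφ : φ ∈ multipliers m E F)
    (w : Ball m) (v : F) :
    ((mulOp φ hφ)†) (RKHS.kerFun (H2 m F) w v) = RKHS.kerFun (H2 m E) w (((φ w)†) v) := by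
  refine ext_inner_right ℂ fun f => ?_
  rw [adjoint_inner_left, RKHS.kerFun_inner, RKHS.kerFun_inner, mulOp_apply, adjoint_inner_left]

theorem smul_mem_multipliers {φ : Ball m → (E →L[ℂ] F)} (hφ : φ ∈ multipliers m E F) (c : ℂ) :
    (fun z => c • φ z) ∈ multipliers m E F := by
  obtain ⟨⟨g, hg, hgφ⟩, h⟩ := hφ
  refine ⟨⟨fun z => c • g z, hg.const_smul c, fun z => congrArg (c • ·) (hgφ z)⟩, fun f => ?_⟩
  obtain ⟨u, hu⟩ := h f
  exact ⟨c • u, fun z => by simp [hu]⟩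

/-- **Leech factorization**: any bounded solution `T` of `M_θ T = M_φ` can be replaced by a
multiplication operator. -/
theorem exists_multiplier_of_mulOp_comp_eq {θ : Ball m → (E →L[ℂ] G)} {φ : Ball m → (F →L[ℂ] G)}
    (hθ : θ ∈ multipliers m E G) (hφ : φ ∈ multipliers m F G) (T : H2 m F →L[ℂ] H2 m E)
    (hT : ∀ f, mulOp θ hθ (T f) = mulOp φ hφ f) :
    ∃ ψ ∈ multipliers m F E, ∀ z, φ z = θ z ∘L ψ z := by
  obtain ⟨c, s, hs⟩ := exists_defect T
  have hTk : ∀ w v, (T†) (RKHS.kerFun (H2 m E) w (((θ w)†) v)) =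
      RKHS.kerFun (H2 m F) w (((φ w)†) v) := by
    intro w v
    rw [← adjoint_mulOp_kerFun hθ, ← adjoint_mulOp_kerFun hφ]
    refine ext_inner_right ℂ fun f => ?_
    rw [adjoint_inner_left, adjoint_inner_left, adjoint_inner_left, hT]
  -- `γ` factors the kernel `(c² θ(z) θ(w)† - φ(z) φ(w)†) / (1 - ⟨z, w⟩)`.
  let γ : Ball m × G → H2 m E := fun p => s (RKHS.kerFun (H2 m E) p.1 (((θ p.1)†) p.2))
  let a : Ball m × G → WithLp 2 (E × PiLp 2 fun _ : Fin m => H2 m E) := fun p =>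
    toLp 2 ((c : ℂ) • ((θ p.1)†) p.2, 0) + ((row E (H2 m E) p.1.1)†) (γ p)
  let b : Ball m × G → WithLp 2 (F × H2 m E) := fun p => toLp 2 (((φ p.1)†) p.2, γ p)
  obtain ⟨W, P, hWa, hP⟩ := exists_partialIsometry_of_inner_eq a b (by
    rintro ⟨w, v⟩ ⟨w', v'⟩
    have h1 := hs (RKHS.kerFun (H2 m E) w (((θ w)†) v)) (RKHS.kerFun (H2 m E) w' (((θ w')†) v'))
    rw [hTk, hTk, inner_smul_left, inner_smul_right, inner_kerFun_kerFun,
      inner_kerFun_kerFun] at h1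
    have h3 := one_sub_inner_ne_zero w w'
    have h4 : inner ℂ (a (w, v)) (a (w', v')) =
        inner ℂ ((c : ℂ) • ((θ w)†) v) ((c : ℂ) • ((θ w')†) v') +
          inner ℂ w'.1 w.1 * inner ℂ (γ (w, v)) (γ (w', v')) :=
      inner_toLp_add_adjoint_row _ _ _ _ _ _
    have h5 : inner ℂ (γ (w, v)) (γ (w', v')) =
        inner ℂ (s (RKHS.kerFun (H2 m E) w (((θ w)†) v)))
          (s (RKHS.kerFun (H2 m E) w' (((θ w')†) v'))) := rfl
    rw [h4, inner_smul_left, inner_smul_right, inner_toLp_toLp, h5]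
    field_simp at h1
    linear_combination h1)
  have hW : ‖W‖ ≤ 1 := by
    refine opNorm_le_bound _ zero_le_one fun x => ?_
    have h1 := congrArg Complex.re (hP x x)
    rw [Complex.add_re, ← RCLike.re_eq_complex_re, inner_self_eq_norm_sq, inner_self_eq_norm_sq,
      inner_self_eq_norm_sq] at h1
    rw [one_mul]
    exact le_of_sq_le_sq (by nlinarith [sq_nonneg ‖P x‖]) (norm_nonneg _)
  refine ⟨fun z => (c : ℂ) • transfer (W†) z.1,
    smul_mem_multipliers (transfer_mem_multipliers hW hP) c, fun z => ?_⟩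
  refine ContinuousLinearMap.ext fun f => ext_inner_left ℂ fun v => ?_
  have h1 := inner_transfer_adjoint hW (mem_ball_zero_iff.mp z.2) (hWa (z, v)) f
  rw [adjoint_inner_left] at h1
  rw [h1, inner_smul_left, adjoint_inner_left, comp_apply, smul_apply, map_smul, inner_smul_right,
    Complex.conj_ofReal]

end Multipliers

end DruryArveson

theorem mainTheorem7 (m : ℕ)
    {E Estar F : Type*}
    [NormedAddCommGroup E] [InnerProductSpace ℂ E] [CompleteSpace E]
    [NormedAddCommGroup Estar] [InnerProductSpace ℂ Estar] [CompleteSpace Estar]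
    [NormedAddCommGroup F] [InnerProductSpace ℂ F] [CompleteSpace F]
    (θ : DruryArveson.Ball m → (E →L[ℂ] Estar))
    (hθ : θ ∈ DruryArveson.multipliers m E Estar)
    (hθ' : DruryArveson.IsPartialIsometry (DruryArveson.mulOp θ hθ) ∨
      IsClosed (Set.range (DruryArveson.mulOp θ hθ)))
    (φ : DruryArveson.Ball m → (F →L[ℂ] Estar))
    (hφ : φ ∈ DruryArveson.multipliers m F Estar) :
    (∃ ψ ∈ DruryArveson.multipliers m F E, ∀ z, φ z = θ z ∘L ψ z) ↔
      Set.range (DruryArveson.mulOp φ hφ) ⊆ Set.range (DruryArveson.mulOp θ hθ) := by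
  constructor
  · rintro ⟨ψ, hψ, h⟩ _ ⟨f, rfl⟩
    refine ⟨DruryArveson.mulOp ψ hψ f, RKHS.ext fun z => ?_⟩
    simp only [DruryArveson.mulOp_apply, h, ContinuousLinearMap.comp_apply]
  · intro h
    obtain ⟨T, hT⟩ := DruryArveson.exists_comp_eq_of_range_subset _ _ h
    exact DruryArveson.exists_multiplier_of_mulOp_comp_eq hθ hφ T hT
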